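/- **Theorem (Regular quotient manifold).** Let $m,d\in\mathbb N$, $p>0$, and let $\sigma:\mathbb R\to\mathbb R$ be $C^1$ on $\mathbb R\setminus\{0\}$ and positively $p$-homogeneous: $\sigma(ct)=c^p\sigma(t)$ for all $c>0$, $t\in\mathbb R$. Let $\Theta=(\mathbb R\times\mathbb R^d)^m$, with points $\theta=((a_1,w_1),\dots,(a_m,w_m))$, and $f_\theta(x)=\sum_{i=1}^m a_i\,\sigma(w_i^\top x)$ for $x\in\mathbb R^d$. Let $G=S_m\ltimes(\mathbb R_{>0})^m$ (with $S_m$ discrete) act on $\Theta$, where $\pi\in S_m$ permutes the $m$ units and $c\in(\mathbb R_{>0})^m$ sends $(a_i,w_i)$ to $(c_i^{-p}a_i,\,c_iw_i)$. For $\theta\in\Theta$ put $$T_\theta(G\cdot\theta)=\{((-p\,\xi_i a_i,\ \xi_i w_i))_{i=1}^m:\ \xi\in\mathbb R^m\}.$$ Let $\mathcal F$ be a real normed space and let $J$ be a linear map from the linear span of the functions $x\mapsto\sigma(w^\top x)$, $w\in\mathbb R^d$, to $\mathcal F$ (for instance an inclusion into a space of functions, the passage to classes in $L^2(\mu)$,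 or the restriction $f\mapsto(f(x_1),\dots,f(x_N))\in\mathbb R^N$ to a finite sample). Let $\Phi:\Theta\to\mathcal F$, $\Phi(\theta)=J(f_\theta)$, be the realization map. Let $\Theta_{\mathrm{reg}}\subset\Theta$ be a $G$-invariant smooth embedded submanifold of dimension $n$ such that 1. the action of $G$ on $\Theta_{\mathrm{reg}}$ is locally free (every $\theta\in\Theta_{\mathrm{reg}}$ has a discrete isotropy group) and proper; 2. $\Phi$ is Fréchet differentiable at every point of $\Theta_{\mathrm{reg}}$, and $\Phi|_{\Theta_{\mathrm{reg}}}$ is of class $C^1$; 3. $\ker D\Phi_\theta=T_\theta(G\cdot\theta)$ for all $\theta\in\Theta_{\mathrm{reg}}$. Then $\mathcal M_{\mathrm{reg}}=\Theta_{\mathrm{reg}}/G$, with the quotient topology, is Hausdorff and second countable, and it carries a structure of a smooth ($C^\infty$) manifold of dimension $n-m$ (if it is non-empty) for which the quotient map $q:\Theta_{\mathrm{reg}}\to\mathcal M_{\mathrm{reg}}$ is a smooth submersion. Moreover $\Phi$ descends to a map $\bar\Phi:\mathcal M_{\mathrm{reg}}\to\mathcal F$, $\bar\Phi([\theta])=\Phi(\theta)$,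 which is of class $C^1$, and of class $C^k$ for every $k\in\mathbb N\cup\{\infty\}$ for which $\Phi|_{\Theta_{\mathrm{reg}}}$ is of class $C^k$. The map $\bar\Phi$ is locally injective, and its differential is injective at every point. -/

import Mathlib

open scoped Manifold ContDiff Topology

noncomputable section

namespace ShallowNet

/-- The parameter space `Θ = (ℝ × ℝ^d)^m`; the `i`-th entry of `θ` is `(a_i, w_i)`. -/
abbrev Param (m d : ℕ) : Type := Fin m → ℝ × EuclideanSpace ℝ (Fin d)

/-- The multiplicative group of positive reals. -/
abbrev PosReal : Type := {c : ℝ // 0 < c}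

/-- The symmetry group `G = S_m ⋉ (ℝ_{>0})^m`. The group `S_m` acts on `(ℝ_{>0})^m` by permuting
coordinates, `(π · c)_i = c_{π⁻¹ i}`. -/
abbrev SymGroup (m : ℕ) : Type :=
  (Fin m → PosReal) ⋊[mulAutArrow (G := Equiv.Perm (Fin m)) (A := Fin m) (M := PosReal)]
    Equiv.Perm (Fin m)

/-- The topology of `G`: the product of the topology of `(ℝ_{>0})^m` and the discrete topology
of `S_m`. -/
instance symGroupTopology (m : ℕ) : TopologicalSpace (SymGroup m) :=
  TopologicalSpace.induced (fun g => g.left) inferInstance ⊓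
    TopologicalSpace.induced (fun g => g.right) ⊥

/-- The action of `G` on `Θ`: `(c, π)` first moves the unit with index `i` to the index `π i`, and
then rescales the unit with index `i` by `(a_i, w_i) ↦ (c_i^{-p} a_i, c_i w_i)`. -/
def act (p : ℝ) {m d : ℕ} (g : SymGroup m) (θ : Param m d) : Param m d :=
  fun i => ((g.left i : ℝ) ^ (-p) * (θ (g.right⁻¹ i)).1, (g.left i : ℝ) • (θ (g.right⁻¹ i)).2)

theorem act_one (p : ℝ) {m d : ℕ} (θ : Param m d) : act p 1 θ = θ := by
  funext i
  simp [act]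

theorem act_mul (p : ℝ) {m d : ℕ} (g h : SymGroup m) (θ : Param m d) :
    act p (g * h) θ = act p g (act p h θ) := by
  funext i
  have hl : (((g * h).left i : PosReal) : ℝ) = (g.left i : ℝ) * (h.left (g.right⁻¹ i) : ℝ) := rfl
  have hr : (g * h).right⁻¹ i = h.right⁻¹ (g.right⁻¹ i) := by
    rw [SemidirectProduct.mul_right, mul_inv_rev, Equiv.Perm.mul_apply]
  simp only [act, hl, hr]
  rw [Real.mul_rpow (g.left i).2.le (h.left _).2.le, mul_assoc, mul_smul]

/-- Two points of a subset `S` of `Θ` are equivalent if they lie in the same `G`-orbit. -/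
def orbitSetoid (p : ℝ) {m d : ℕ} (S : Set (Param m d)) : Setoid S where
  r x y := ∃ g : SymGroup m, act p g (x : Param m d) = y
  iseqv :=
    { refl := fun x => ⟨1, act_one p _⟩
      symm := by
        rintro x y ⟨g, hg⟩
        exact ⟨g⁻¹, by rw [← hg, ← act_mul, inv_mul_cancel, act_one]⟩
      trans := by
        rintro x y z ⟨g, hg⟩ ⟨h, hh⟩
        exact ⟨h * g, by rw [act_mul, hg, hh]⟩ }

/-- The orbit space `S / G`, with the quotient topology. -/
abbrev OrbitSpace (p : ℝ) {m d : ℕ} (S : Set (Param m d)) : Type := Quotient (orbitSetoid p S)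

/-- The quotient map `S → S / G`. -/
def proj (p : ℝ) {m d : ℕ} (S : Set (Param m d)) (θ : S) : OrbitSpace p S :=
  Quotient.mk (orbitSetoid p S) θ

/-- `S` is invariant under `G`. -/
def IsInvariant (p : ℝ) {m d : ℕ} (S : Set (Param m d)) : Prop :=
  ∀ (g : SymGroup m), ∀ θ ∈ S, act p g θ ∈ S

/-- The action of `G` is locally free at `θ`: the isotropy group of `θ` is discrete. -/
def IsLocallyFreeAt (p : ℝ) {m d : ℕ} (θ : Param m d) : Prop :=
  DiscreteTopology {g : SymGroup m // act p g θ = θ}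

/-- The action of `G` on an invariant set `S` is proper: `(g, θ) ↦ (g · θ, θ)` is a proper map
`G × S → S × S`. -/
def IsProperAction (p : ℝ) {m d : ℕ} (S : Set (Param m d)) (hS : IsInvariant p S) : Prop :=
  IsProperMap (fun x : SymGroup m × S =>
    ((⟨act p x.1 (x.2 : Param m d), hS x.1 _ x.2.2⟩, x.2) : S × S))

/-- The infinitesimal action at `θ`: the velocity at `t = 0` of the curve
`t ↦ ((e^{-p t ξ_i} a_i, e^{t ξ_i} w_i))_i` in the orbit of `θ`, as a linear function of `ξ`. -/
def infinitesimalAction (p : ℝ) {m d : ℕ} (θ : Param m d) : (Fin m → ℝ) →ₗ[ℝ] Param m d where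
  toFun ξ := fun i => (-p * ξ i * (θ i).1, ξ i • (θ i).2)
  map_add' ξ η := by
    funext i
    ext1
    · simp only [Pi.add_apply, Prod.fst_add]; ring
    · simp only [Pi.add_apply, Prod.snd_add, add_smul]
  map_smul' r ξ := by
    funext i
    ext1
    · simp only [Pi.smul_apply, Prod.smul_fst, smul_eq_mul, RingHom.id_apply]; ring
    · simp only [Pi.smul_apply, Prod.smul_snd, smul_eq_mul, RingHom.id_apply, mul_smul]

/-- The tangent space `T_θ(G · θ)` of the orbit of `θ`. -/
def orbitTangent (p : ℝ) {m d : ℕ} (θ : Param m d) : Submodule ℝ (Param m d) :=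
  LinearMap.range (infinitesimalAction p θ)

/-- The realized function `f_θ(x) = ∑ i, a_i σ(⟨w_i, x⟩)`. -/
def realize (σ : ℝ → ℝ) {m d : ℕ} (θ : Param m d) : EuclideanSpace ℝ (Fin d) → ℝ :=
  fun x => ∑ i, (θ i).1 * σ (inner ℝ (θ i).2 x)

/-- The linear span of the feature functions `x ↦ σ(⟨w, x⟩)`, a space of functions on `ℝ^d`. -/
def featureSpan (σ : ℝ → ℝ) (d : ℕ) : Submodule ℝ (EuclideanSpace ℝ (Fin d) → ℝ) :=
  Submodule.span ℝ (Set.range fun (w : EuclideanSpace ℝ (Fin d)) x => σ (inner ℝ w x))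

theorem realize_mem (σ : ℝ → ℝ) {m d : ℕ} (θ : Param m d) :
    realize σ θ ∈ featureSpan σ d := by
  have h : realize σ θ = ∑ i, (θ i).1 • (fun x => σ (inner ℝ (θ i).2 x)) := by
    funext x
    simp [realize, Finset.sum_apply]
  rw [h]
  exact Submodule.sum_mem _ fun i _ =>
    Submodule.smul_mem _ _ (Submodule.subset_span ⟨(θ i).2, rfl⟩)

/-- The realization map `Φ(θ) = f_θ`, with values in the normed space `F`. The linear map `J` sends
a function in the span of the features to the element of `F` that it represents: the function
itself if `F` is a space of functions on `ℝ^d`, its restriction to a compact set for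
`F = C(K)`, its class for `F = L²(μ)`, its vector of values `(f(x_1), …, f(x_n))` on a finite sample
for `F = ℝ^n`. -/
def realization (σ : ℝ → ℝ) {d : ℕ} {F : Type*} [AddCommGroup F] [Module ℝ F]
    (J : featureSpan σ d →ₗ[ℝ] F) {m : ℕ} (θ : Param m d) : F :=
  J ⟨realize σ θ, realize_mem σ θ⟩

end ShallowNet

end

/-! The orbits have local slices, and the realization map itself separates the orbits near each
point. Local freeness forces every unit to be nonzero, so the logarithm of a nonzero coordinate of
each unit, suitably normalized, gives a function `H` with `H (exp ξ · θ) = ξ + H θ`. Its zero level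
is a slice for the scaling group, and `θ ↦ exp (-H θ) · θ` retracts onto it along orbits. Since `ker
DΦ` consists of orbit directions, which are transverse to the slice, `Φ` has injective differential
on the slice and is locally injective there. As `Φ` is `G`-invariant, nearby points of one `G`-orbit
retract to the same slice point, even if a permutation relates them. Slices are thus charts of the
quotient (`exists_localQuotient`, `IsOpenQuotientMap.exists_isManifold`).

Properness makes the orbit relation closed, hence the quotient Hausdorff. Locally `Φbar` is `Φ`
composed with a smooth section of `q`, which gives its regularity; the kernel condition gives the
injectivity of its differential. -/

noncomputable section

/-! ### Inverse function theorem and local injectivity. -/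

section Calculus

/-- A map with an injective strict derivative on a finite-dimensional space is locally injective. -/
theorem HasStrictFDerivAt.exists_injOn_of_injective {E F : Type*} [NormedAddCommGroup E]
    [NormedSpace ℝ E] [FiniteDimensional ℝ E] [NormedAddCommGroup F] [NormedSpace ℝ F]
    {f : E → F} {f' : E →L[ℝ] F} {a : E} (hf : HasStrictFDerivAt f f' a)
    (hinj : Function.Injective f') : ∃ U ∈ 𝓝 a, Set.InjOn f U := by
  obtain ⟨K, hK, hanti⟩ := LinearMap.exists_antilipschitzWith (f' : E →ₗ[ℝ] F)
    (LinearMap.ker_eq_bot.2 hinj)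
  -- Half of the lower bound `K⁻¹` of `f'`: the error of linearization cannot cancel the linear
  -- term.
  have hK' : (0 : NNReal) < (2 * K)⁻¹ := by positivity
  obtain ⟨U, hU, happ⟩ := hf.approximates_deriv_on_nhds (c := (2 * K)⁻¹) (Or.inr hK')
  refine ⟨U, hU, fun x hx y hy hxy => ?_⟩
  have h1 := happ x hx y hy
  rw [hxy, sub_self, zero_sub, norm_neg] at h1
  have h2 := hanti.le_mul_dist x y
  rw [dist_eq_norm, dist_eq_norm, ContinuousLinearMap.coe_coe, ← map_sub] at h2
  have hKpos : (0 : ℝ) < K := hK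
  have h3 : (K : ℝ) * ‖f' (x - y)‖ ≤ K * ((2 * K)⁻¹ * ‖x - y‖) := by
    gcongr
  have h4 : (K : ℝ) * ((2 * K)⁻¹ * ‖x - y‖) = ‖x - y‖ / 2 := by
    push_cast
    field_simp
  have h5 : ‖x - y‖ ≤ 0 := by linarith
  exact sub_eq_zero.1 (norm_le_zero_iff.1 h5)

/-- The smooth inverse function theorem: a smooth map with an invertible derivative restricts to
a homeomorphism between open sets with a smooth inverse. -/
theorem ContDiffOn.exists_openPartialHomeomorph {E F : Type*} [NormedAddCommGroup E]
    [NormedSpace ℝ E] [CompleteSpace E] [NormedAddCommGroup F] [NormedSpace ℝ F]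
    {f : E → F} {O : Set E} (hO : IsOpen O) (hf : ContDiffOn ℝ ∞ f O) {a : E} (ha : a ∈ O)
    (f' : E ≃L[ℝ] F) (hf' : HasFDerivAt f (f' : E →L[ℝ] F) a) :
    ∃ h : OpenPartialHomeomorph E F, a ∈ h.source ∧ h.source ⊆ O ∧ ⇑h = f ∧
      ContDiffOn ℝ ∞ h.symm h.target := by
  have hfa : ContDiffAt ℝ ∞ f a := hf.contDiffAt (hO.mem_nhds ha)
  have hcont : ContinuousOn (fderiv ℝ f) O := hf.continuousOn_fderiv_of_isOpen hO (by simp)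
  -- The inverse is smooth at images of points with invertible derivative; these form an open set,
  -- to which the domain is shrunk.
  have hO' : IsOpen (O ∩ fderiv ℝ f ⁻¹' Set.range ((↑) : (E ≃L[ℝ] F) → E →L[ℝ] F)) :=
    hcont.isOpen_inter_preimage hO ContinuousLinearEquiv.isOpen
  let h₀ := hfa.toOpenPartialHomeomorph f hf' (by simp)
  refine ⟨h₀.restrOpen _ hO', ?_, ?_, ?_, ?_⟩
  · exact ⟨hfa.mem_toOpenPartialHomeomorph_source hf' _, ha, f', hf'.fderiv.symm⟩
  · exact fun x hx => hx.2.1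
  · rfl
  · intro b hb
    have hb' := (h₀.restrOpen _ hO').map_target hb
    obtain ⟨-, hbO, e, he⟩ := hb'
    refine ((h₀.restrOpen _ hO').contDiffAt_symm hb (f₀' := e) ?_ ?_).contDiffWithinAt
    · rw [he]
      exact ((hf.contDiffAt (hO.mem_nhds hbO)).differentiableAt (by simp)).hasFDerivAt
    · exact hf.contDiffAt (hO.mem_nhds hbO)

/-- A surjective linear map between finite-dimensional spaces can be completed to an isomorphism
onto a product. -/
theorem ContinuousLinearMap.exists_prod_equiv_of_surjective {E F G : Type*} [NormedAddCommGroup E]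
    [NormedSpace ℝ E] [FiniteDimensional ℝ E] [NormedAddCommGroup F] [NormedSpace ℝ F]
    [FiniteDimensional ℝ F] [NormedAddCommGroup G] [NormedSpace ℝ G] [FiniteDimensional ℝ G]
    (hdim : Module.finrank ℝ E = Module.finrank ℝ F + Module.finrank ℝ G)
    (A : E →L[ℝ] F) (hA : Function.Surjective A) :
    ∃ (L : E →L[ℝ] G) (e : E ≃L[ℝ] F × G), (e : E →L[ℝ] F × G) = A.prod L := by
  have hker : Module.finrank ℝ (LinearMap.ker (A : E →ₗ[ℝ] F)) = Module.finrank ℝ G := by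
    have h := LinearMap.finrank_range_add_finrank_ker (A : E →ₗ[ℝ] F)
    rw [LinearMap.range_eq_top.2 hA, finrank_top] at h
    omega
  let k : LinearMap.ker (A : E →ₗ[ℝ] F) ≃ₗ[ℝ] G := LinearEquiv.ofFinrankEq _ _ hker
  obtain ⟨π, hπ⟩ := Submodule.exists_isCompl (LinearMap.ker (A : E →ₗ[ℝ] F))
  let P := (LinearMap.ker (A : E →ₗ[ℝ] F)).projectionOnto π hπ
  let L : E →L[ℝ] G := LinearMap.toContinuousLinearMap (k.toLinearMap ∘ₗ P)
  -- On `ker A` the projection `P` is the identity, so `L` is injective there; the dimension count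
  -- does the rest.
  have hinj : Function.Injective ((A.prod L : E →L[ℝ] F × G) : E →ₗ[ℝ] F × G) := by
    rw [← LinearMap.ker_eq_bot, LinearMap.ker_eq_bot']
    intro x hx
    have h1 : A x = 0 := congrArg Prod.fst hx
    have h2 : k (P x) = 0 := congrArg Prod.snd hx
    rw [LinearEquiv.map_eq_zero_iff] at h2
    have h3 : P ((⟨x, h1⟩ : LinearMap.ker (A : E →ₗ[ℝ] F)) : E) = ⟨x, h1⟩ :=
      Submodule.projectionOnto_apply_left hπ _
    have h4 := h3.symm.trans h2
    exact congrArg Subtype.val h4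
  let e := (LinearEquiv.ofInjectiveOfFinrankEq _ hinj
    (by rw [Module.finrank_prod, hdim])).toContinuousLinearEquiv
  exact ⟨L, e, by ext <;> rfl⟩

end Calculus

/-! ### Level sets of submersions and immersions. -/

section Manifolds

variable {E F G : Type*} [NormedAddCommGroup E] [NormedSpace ℝ E] [NormedAddCommGroup F]
  [NormedSpace ℝ F] [NormedAddCommGroup G] [NormedSpace ℝ G]
  {X : Type*} [TopologicalSpace X] [ChartedSpace E X]

/-- A level set of a submersion is parametrized, near a given point, by an open subset of a
vector space. -/
theorem exists_levelSet_parametrization [IsManifold 𝓘(ℝ, E) ∞ X] [FiniteDimensional ℝ E]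
    [FiniteDimensional ℝ F] [FiniteDimensional ℝ G]
    (hdim : Module.finrank ℝ E = Module.finrank ℝ F + Module.finrank ℝ G)
    {H : X → F} {U : Set X} (hU : IsOpen U) (hH : ContMDiffOn 𝓘(ℝ, E) 𝓘(ℝ, F) ∞ H U)
    {x₀ : X} (hx₀ : x₀ ∈ U) (hsurj : Function.Surjective (mfderiv 𝓘(ℝ, E) 𝓘(ℝ, F) H x₀)) :
    ∃ (W : Set X) (V : Set G) (s : G → X) (ρ : X → G), IsOpen W ∧ IsOpen V ∧ x₀ ∈ W ∧ W ⊆ U ∧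
      ContMDiffOn 𝓘(ℝ, E) 𝓘(ℝ, G) ∞ ρ W ∧ ContMDiffOn 𝓘(ℝ, G) 𝓘(ℝ, E) ∞ s V ∧
      (∀ x ∈ W, H x = H x₀ → ρ x ∈ V ∧ s (ρ x) = x) ∧
      ∀ v ∈ V, s v ∈ W ∧ H (s v) = H x₀ ∧ ρ (s v) = v := by
  set φ := chartAt E x₀
  have hxφ : x₀ ∈ φ.source := mem_chart_source E x₀
  have hφs : ContMDiffOn 𝓘(ℝ, E) 𝓘(ℝ, E) ∞ φ φ.source := contMDiffOn_chart
  have hφt : ContMDiffOn 𝓘(ℝ, E) 𝓘(ℝ, E) ∞ φ.symm φ.target := contMDiffOn_chart_symm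
  set O : Set E := φ.target ∩ φ.symm ⁻¹' U
  have hO : IsOpen O := φ.symm.isOpen_inter_preimage hU
  have hz₀ : φ x₀ ∈ O := ⟨φ.map_source hxφ, by simpa [φ.left_inv hxφ] using hx₀⟩
  have hHO : ContDiffOn ℝ ∞ (H ∘ φ.symm) O :=
    contMDiffOn_iff_contDiffOn.1 (hH.comp (hφt.mono Set.inter_subset_left) fun z hz => hz.2)
  have hA : HasFDerivAt (H ∘ φ.symm) (fderiv ℝ (H ∘ φ.symm) (φ x₀)) (φ x₀) :=
    ((hHO.contDiffAt (hO.mem_nhds hz₀)).differentiableAt (by simp)).hasFDerivAt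
  have hAsurj : Function.Surjective (fderiv ℝ (H ∘ φ.symm) (φ x₀)) := by
    have hHx : MDifferentiableAt 𝓘(ℝ, E) 𝓘(ℝ, F) H x₀ :=
      ((hH.contMDiffAt (hU.mem_nhds hx₀)).mdifferentiableAt (by simp))
    rw [hHx.mfderiv] at hsurj
    simp only [mfld_simps, fderivWithin_univ] at hsurj
    exact hsurj
  obtain ⟨L, e, he⟩ := ContinuousLinearMap.exists_prod_equiv_of_surjective hdim
    (G := G) (fderiv ℝ (H ∘ φ.symm) (φ x₀)) hAsurj
  -- In the coordinates `(H, L)` the level set is a piece of `{H x₀} × G`, so `L` parametrizes it.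
  obtain ⟨h, hz₀h, hhO, hh, hhs⟩ := ContDiffOn.exists_openPartialHomeomorph hO
    (hHO.prodMk L.contDiff.contDiffOn) hz₀ e (by rw [he]; exact hA.prodMk L.hasFDerivAt)
  have hh' : ∀ z, h z = (H (φ.symm z), L z) := fun z => by rw [hh]; rfl
  refine ⟨φ.source ∩ φ ⁻¹' h.source, (fun v => (H x₀, v)) ⁻¹' h.target,
    fun v => φ.symm (h.symm (H x₀, v)), fun x => L (φ x),
    φ.isOpen_inter_preimage h.open_source, h.open_target.preimage (by fun_prop),
    ⟨hxφ, hz₀h⟩, ?_, ?_, ?_, ?_, ?_⟩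
  · intro x hx
    simpa [φ.left_inv hx.1] using (hhO hx.2).2
  · exact L.contMDiff.comp_contMDiffOn (hφs.mono Set.inter_subset_left)
  · have h1 : ContMDiffOn 𝓘(ℝ, G) 𝓘(ℝ, E) ∞ (fun v => h.symm (H x₀, v))
        ((fun v => (H x₀, v)) ⁻¹' h.target) :=
      contMDiffOn_iff_contDiffOn.2 (hhs.comp (by fun_prop) fun v hv => hv)
    exact hφt.comp h1 fun v hv => (hhO (h.map_target hv)).1
  · intro x hx hHx
    have h1 : h (φ x) = (H x₀, L (φ x)) := by rw [hh', φ.left_inv hx.1, hHx]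
    refine ⟨?_, ?_⟩
    · change (H x₀, L (φ x)) ∈ h.target
      rw [← h1]
      exact h.map_source hx.2
    · change φ.symm (h.symm (H x₀, L (φ x))) = x
      rw [← h1, h.left_inv hx.2, φ.left_inv hx.1]
  · intro v hv
    have h1 : h.symm (H x₀, v) ∈ h.source := h.map_target hv
    have h2 := (hhO h1).1
    have h3 := hh' (h.symm (H x₀, v))
    rw [h.right_inv hv, Prod.mk.injEq] at h3
    refine ⟨⟨φ.map_target h2, ?_⟩, h3.1.symm, ?_⟩
    · change φ (φ.symm (h.symm (H x₀, v))) ∈ h.source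
      rwa [φ.right_inv h2]
    · change L (φ (φ.symm (h.symm (H x₀, v)))) = v
      rw [φ.right_inv h2, ← h3.2]

/-- The differential of an immersion is injective. -/
theorem Manifold.IsImmersionAt.mfderiv_injective {f : X → F} {x : X}
    [IsManifold 𝓘(ℝ, E) ∞ X]
    (hf : Manifold.IsImmersionAt 𝓘(ℝ, E) 𝓘(ℝ, F) ∞ f x) :
    Function.Injective (mfderiv 𝓘(ℝ, E) 𝓘(ℝ, F) f x) := by
  -- In adapted charts `f` is `z ↦ (z, 0)`; projecting to the first factor gives a smooth local left
  -- inverse.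
  let g : F → X := fun y => hf.domChart.symm ((hf.equiv.symm (hf.codChart y)).1)
  have hcod : ContMDiffAt 𝓘(ℝ, F) 𝓘(ℝ, F) ∞ hf.codChart (f x) :=
    contMDiffAt_of_mem_maximalAtlas hf.codChart_mem_maximalAtlas hf.mem_codChart_source
  have hgf : ∀ z ∈ hf.domChart.source, (hf.equiv.symm (hf.codChart (f z))).1 = hf.domChart z := by
    intro z hz
    have h1 := hf.writtenInCharts ((hf.domChart.extend 𝓘(ℝ, E)).map_source
      (by rwa [OpenPartialHomeomorph.extend_source]))
    simp only [Function.comp_apply, mfld_simps] at h1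
    rw [hf.domChart.left_inv hz] at h1
    rw [h1]
    simp
  have hg : ContMDiffAt 𝓘(ℝ, F) 𝓘(ℝ, E) ∞ g (f x) := by
    have h2 : ContMDiffAt 𝓘(ℝ, F) 𝓘(ℝ, E) ∞
        (fun y => (hf.equiv.symm (hf.codChart y)).1) (f x) := by
      refine ContMDiffAt.comp (f x) (g := fun z => (hf.equiv.symm z).1) ?_ hcod
      exact ((ContDiff.fst hf.equiv.symm.contDiff).contMDiff _)
    refine ContMDiffAt.comp (f x) ?_ h2
    have h3 := hgf x hf.mem_domChart_source
    rw [h3]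
    exact contMDiffAt_symm_of_mem_maximalAtlas hf.domChart_mem_maximalAtlas
      (hf.domChart.map_source hf.mem_domChart_source)
  have hid : g ∘ f =ᶠ[𝓝 x] id := by
    filter_upwards [hf.domChart.open_source.mem_nhds hf.mem_domChart_source] with z hz
    simp only [g, Function.comp_apply, id]
    rw [hgf z hz, hf.domChart.left_inv hz]
  have hcomp := mfderiv_comp x (hg.mdifferentiableAt (by simp))
    (hf.contMDiffAt.mdifferentiableAt (by simp))
  rw [hid.mfderiv_eq, mfderiv_id] at hcomp
  intro v w hvw
  have hv := DFunLike.congr_fun hcomp v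
  have hw := DFunLike.congr_fun hcomp w
  have : v = w := by
    refine hv.trans (Eq.trans ?_ hw.symm)
    exact congrArg (mfderiv 𝓘(ℝ, F) 𝓘(ℝ, E) g (f x)) hvw
  exact this

end Manifolds

/-! ### Manifold structure on an open quotient. -/

section QuotientManifold

variable {E G : Type*} [NormedAddCommGroup E] [NormedSpace ℝ E]
  [NormedAddCommGroup G] [NormedSpace ℝ G]
  {X Y : Type*} [TopologicalSpace X] [ChartedSpace E X] [TopologicalSpace Y]

/-- A smooth map `ψ` on an open set `U` with a smooth section `s` over its image `V`, whose
fibres are the traces on `U` of the fibres of `q`. -/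
structure LocalQuotient (E G : Type*) [NormedAddCommGroup E] [NormedSpace ℝ E]
    [NormedAddCommGroup G] [NormedSpace ℝ G] {X Y : Type*} [TopologicalSpace X]
    [ChartedSpace E X] (q : X → Y) where
  U : Set X
  V : Set G
  ψ : X → G
  s : G → X
  isOpen_U : IsOpen U
  isOpen_V : IsOpen V
  contMDiffOn_ψ : ContMDiffOn 𝓘(ℝ, E) 𝓘(ℝ, G) ∞ ψ U
  contMDiffOn_s : ContMDiffOn 𝓘(ℝ, G) 𝓘(ℝ, E) ∞ s V
  ψ_mem : ∀ x ∈ U, ψ x ∈ V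
  s_mem : ∀ v ∈ V, s v ∈ U
  ψ_s : ∀ v ∈ V, ψ (s v) = v
  eq_iff : ∀ a ∈ U, ∀ b ∈ U, q a = q b ↔ ψ a = ψ b

namespace LocalQuotient

variable {q : X → Y}

omit [TopologicalSpace Y] in
theorem q_s_ψ (D : LocalQuotient E G q) {x : X} (hx : x ∈ D.U) : q (D.s (D.ψ x)) = q x :=
  (D.eq_iff _ (D.s_mem _ (D.ψ_mem x hx)) _ hx).2 (D.ψ_s _ (D.ψ_mem x hx))

/-- The chart of the quotient which `ψ` induces, as a partial function. -/
def chartFun [Nonempty X] (D : LocalQuotient E G q) (y : Y) : G := D.ψ (Function.invFunOn q D.U y)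

-- The choice made by `invFunOn` is immaterial, because `ψ` is constant on the traces of the fibres.
omit [TopologicalSpace Y] in
theorem chartFun_q [Nonempty X] (D : LocalQuotient E G q) {x : X} (hx : x ∈ D.U) :
    D.chartFun (q x) = D.ψ x := by
  have h : ∃ a ∈ D.U, q a = q x := ⟨x, hx, rfl⟩
  exact (D.eq_iff _ (Function.invFunOn_mem h) _ hx).1 (Function.invFunOn_eq h)

/-- The chart of the quotient induced by `ψ`. -/
def chart [Nonempty X] (D : LocalQuotient E G q) (hq : IsOpenQuotientMap q) :
    OpenPartialHomeomorph Y G where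
  toFun := D.chartFun
  invFun v := q (D.s v)
  source := q '' D.U
  target := D.V
  map_source' := by
    rintro _ ⟨x, hx, rfl⟩
    rw [D.chartFun_q hx]
    exact D.ψ_mem x hx
  map_target' v hv := ⟨D.s v, D.s_mem v hv, rfl⟩
  left_inv' := by
    rintro _ ⟨x, hx, rfl⟩
    rw [D.chartFun_q hx, D.q_s_ψ hx]
  right_inv' v hv := by rw [D.chartFun_q (D.s_mem v hv), D.ψ_s v hv]
  open_source := hq.isOpenMap _ D.isOpen_U
  open_target := D.isOpen_V
  continuousOn_toFun := by
    rintro _ ⟨x, hx, rfl⟩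
    refine ContinuousAt.continuousWithinAt ?_
    -- An open quotient map pushes neighbourhood filters forward, so continuity can be tested
    -- upstairs.
    rw [ContinuousAt, ← hq.map_nhds_eq, Filter.tendsto_map'_iff, D.chartFun_q hx]
    have h := (D.contMDiffOn_ψ.contMDiffAt (D.isOpen_U.mem_nhds hx)).continuousAt
    refine Filter.Tendsto.congr' ?_ h
    filter_upwards [D.isOpen_U.mem_nhds hx] with z hz
    exact (D.chartFun_q hz).symm
  continuousOn_invFun := hq.continuous.comp_continuousOn D.contMDiffOn_s.continuousOn

/-- Near a point whose image lies in the domain of a chart, the composition of the chart with `q`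
is smooth, provided that `q` has enough smooth symmetries. -/
theorem contMDiffAt_chart_comp [Nonempty X] (D : LocalQuotient E G q) (hq : IsOpenQuotientMap q)
    (hsymm : ∀ x x' : X, q x = q x' →
      ∃ γ : X → X, ContMDiff 𝓘(ℝ, E) 𝓘(ℝ, E) ∞ γ ∧ γ x = x' ∧ ∀ z, q (γ z) = q z)
    {x : X} (hx : q x ∈ (D.chart hq).source) :
    ContMDiffAt 𝓘(ℝ, E) 𝓘(ℝ, G) ∞ (D.chart hq ∘ q) x := by
  obtain ⟨x', hx', hxx'⟩ := hx
  -- The point `x` may lie outside `D.U`; `γ` moves it inside along its fibre, and near `x` the map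
  -- is `ψ ∘ γ`.
  obtain ⟨γ, hγ, hγx, hqγ⟩ := hsymm x x' hxx'.symm
  have h1 : ContMDiffAt 𝓘(ℝ, E) 𝓘(ℝ, G) ∞ (D.ψ ∘ γ) x := by
    refine ContMDiffAt.comp x ?_ (hγ x)
    rw [hγx]
    exact D.contMDiffOn_ψ.contMDiffAt (D.isOpen_U.mem_nhds hx')
  refine h1.congr_of_eventuallyEq ?_
  have hU : D.U ∈ 𝓝 (γ x) := by
    rw [hγx]
    exact D.isOpen_U.mem_nhds hx'
  filter_upwards [hγ.continuous.continuousAt.preimage_mem_nhds hU] with z hz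
  change D.chartFun (q z) = D.ψ (γ z)
  rw [← hqγ z, D.chartFun_q hz]

end LocalQuotient

/-- An open quotient of a smooth manifold is a smooth manifold, and the quotient map has smooth
local sections through all points, if the fibres of the quotient map are locally the fibres of
submersions, and any two points of a fibre are related by a smooth map over the quotient. -/
theorem IsOpenQuotientMap.exists_isManifold [IsManifold 𝓘(ℝ, E) ∞ X] {q : X → Y}
    (hq : IsOpenQuotientMap q)
    (hsymm : ∀ x x' : X, q x = q x' →
      ∃ γ : X → X, ContMDiff 𝓘(ℝ, E) 𝓘(ℝ, E) ∞ γ ∧ γ x = x' ∧ ∀ z, q (γ z) = q z)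
    (hloc : ∀ x : X, ∃ D : LocalQuotient E G q, x ∈ D.U) :
    ∃ _ : ChartedSpace G Y, IsManifold 𝓘(ℝ, G) ∞ Y ∧ ContMDiff 𝓘(ℝ, E) 𝓘(ℝ, G) ∞ q ∧
      ∀ x : X, ∃ t : Y → X, t (q x) = x ∧ ContMDiffAt 𝓘(ℝ, G) 𝓘(ℝ, E) ∞ t (q x) ∧
        ∀ᶠ y in 𝓝 (q x), q (t y) = y := by
  rcases isEmpty_or_nonempty X with hX | hX
  · have hY : IsEmpty Y := ⟨fun y => (hq.surjective y).elim fun x _ => hX.elim x⟩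
    exact ⟨ChartedSpace.empty G Y, inferInstance, fun x => hX.elim x, fun x => hX.elim x⟩
  choose D hD using hloc
  choose r hr using hq.surjective
  let cs : ChartedSpace G Y :=
    { atlas := Set.range fun x => (D x).chart hq
      chartAt := fun y => (D (r y)).chart hq
      mem_chart_source := fun y => ⟨r y, hD _, hr y⟩
      chart_mem_atlas := fun y => ⟨r y, rfl⟩ }
  have hs : ∀ (D : LocalQuotient E G q), ∀ v ∈ D.V, ContMDiffAt 𝓘(ℝ, G) 𝓘(ℝ, E) ∞ D.s v :=
    fun D v hv => D.contMDiffOn_s.contMDiffAt (D.isOpen_V.mem_nhds hv)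
  have hman : IsManifold 𝓘(ℝ, G) ∞ Y := by
    refine isManifold_of_contDiffOn _ _ _ ?_
    rintro _ _ ⟨x, rfl⟩ ⟨x', rfl⟩
    simp only [mfld_simps]
    intro v hv
    -- A transition map is the second chart after `q`, precomposed with the section of the first.
    have h1 := ((D x').contMDiffAt_chart_comp hq hsymm hv.2).comp v (hs (D x) v hv.1)
    exact (contMDiffAt_iff_contDiffAt.1 h1).contDiffWithinAt
  refine ⟨cs, hman, fun x => ?_, fun x => ?_⟩
  · rw [contMDiffAt_iff_target]
    refine ⟨hq.continuous.continuousAt, ?_⟩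
    exact (D (r (q x))).contMDiffAt_chart_comp hq hsymm (mem_chart_source G (q x))
  · let D' := D (r (q x))
    have hx : q x ∈ (D'.chart hq).source := mem_chart_source G (q x)
    have hmem : D'.chart hq (q x) ∈ D'.V := (D'.chart hq).map_source hx
    have hqs : ∀ y ∈ (D'.chart hq).source, q (D'.s (D'.chart hq y)) = y := fun y hy =>
      (D'.chart hq).left_inv hy
    -- The section of the chart meets the fibre at some point; `γ` carries that point to `x`.
    obtain ⟨γ, hγ, hγx, hqγ⟩ := hsymm _ x (hqs _ hx)
    refine ⟨fun y => γ (D'.s (D'.chart hq y)), hγx, ?_, ?_⟩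
    · have h1 : ContMDiffAt 𝓘(ℝ, G) 𝓘(ℝ, G) ∞ (D'.chart hq) (q x) :=
        contMDiffAt_of_mem_maximalAtlas (IsManifold.chart_mem_maximalAtlas (q x)) hx
      exact (hγ _).comp (q x) ((hs D' _ hmem).comp (q x) h1)
    · filter_upwards [(D'.chart hq).open_source.mem_nhds hx] with y hy
      rw [hqγ, hqs y hy]

end QuotientManifold

/-! ### The scaling action and logarithmic coordinates. -/

namespace ShallowNet

variable {m d : ℕ}

theorem contDiff_act (p : ℝ) (g : SymGroup m) :
    ContDiff ℝ ∞ (act p g : Param m d → Param m d) := by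
  refine contDiff_pi.2 fun i => ?_
  unfold act
  fun_prop

/-- The action of the one-parameter subgroups of `(ℝ_{>0})^m`, parametrized by the logarithms of
the scaling factors. -/
def expScale (p : ℝ) (ξ : Fin m → ℝ) (θ : Param m d) : Param m d :=
  fun i => (Real.exp (-p * ξ i) * (θ i).1, Real.exp (ξ i) • (θ i).2)

theorem expScale_eq_act (p : ℝ) (ξ : Fin m → ℝ) (θ : Param m d) :
    expScale p ξ θ = act p ⟨fun i => ⟨Real.exp (ξ i), Real.exp_pos _⟩, 1⟩ θ := by
  funext i
  have h : Real.exp (-p * ξ i) = Real.exp (ξ i) ^ (-p) := by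
    rw [← Real.exp_mul, mul_comm]
  simp only [expScale, act, h, inv_one, Equiv.Perm.one_apply]

theorem expScale_zero (p : ℝ) (θ : Param m d) : expScale p 0 θ = θ := by
  funext i
  simp [expScale]

theorem contDiff_expScale (p : ℝ) :
    ContDiff ℝ ∞ (fun z : (Fin m → ℝ) × Param m d => expScale p z.1 z.2) := by
  refine contDiff_pi.2 fun i => ?_
  unfold expScale
  fun_prop

/-- Differentiating along `t ↦ t • ξ` reduces this to scalar exponentials. It turns the algebraic
`orbitTangent` into actual orbit velocities. -/
theorem fderiv_expScale (p : ℝ) (θ : Param m d) (ξ : Fin m → ℝ) :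
    fderiv ℝ (fun η => expScale p η θ) 0 ξ = infinitesimalAction p θ ξ := by
  have hline : HasDerivAt (fun t : ℝ => t • ξ) ξ 0 := by
    simpa using (hasDerivAt_id (0 : ℝ)).smul_const ξ
  have hdiff : DifferentiableAt ℝ (fun η : Fin m → ℝ => expScale p η θ) ((0 : ℝ) • ξ) :=
    ((contDiff_expScale p).comp (contDiff_id.prodMk contDiff_const)).differentiable (by simp) _
  have h1 := hdiff.hasFDerivAt.comp_hasDerivAt 0 hline
  rw [zero_smul] at h1
  refine h1.unique (hasDerivAt_pi.2 fun i => ?_)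
  have hexp : ∀ c : ℝ, HasDerivAt (fun t : ℝ => Real.exp (c * (t * ξ i))) (c * ξ i) 0 := by
    intro c
    have := (((hasDerivAt_id (0 : ℝ)).mul_const (ξ i)).const_mul c).exp
    simpa using this
  have h2 := (hexp (-p)).mul_const (θ i).1
  have h3 := (hexp 1).smul_const (θ i).2
  simp only [one_mul] at h3
  exact h2.prodMk h3

/-- Homogeneity produces `c ^ p`, which cancels the factor `c ^ (-p)` of the outer weight;
permutations only reindex the sum. -/
theorem realization_act {σ : ℝ → ℝ} {p : ℝ} (hσ : ∀ c t : ℝ, 0 < c → σ (c * t) = c ^ p * σ t)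
    {F : Type*} [AddCommGroup F] [Module ℝ F] (J : featureSpan σ d →ₗ[ℝ] F) (g : SymGroup m)
    (θ : Param m d) : realization σ J (act p g θ) = realization σ J θ := by
  have h : realize σ (act p g θ) = realize σ θ := by
    funext x
    unfold realize
    rw [← Equiv.sum_comp g.right⁻¹ fun i => (θ i).1 * σ (inner ℝ (θ i).2 x)]
    refine Finset.sum_congr rfl fun i _ => ?_
    have hc : 0 < (g.left i : ℝ) := (g.left i).2
    simp only [act, real_inner_smul_left]
    rw [hσ _ _ hc, Real.rpow_neg hc.le]
    field_simp
  unfold realization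
  congr 1
  exact Subtype.ext h

/-- No unit vanishes at a point where the action is locally free. -/
theorem IsLocallyFreeAt.apply_ne_zero {p : ℝ} {θ : Param m d} (h : IsLocallyFreeAt p θ)
    (i : Fin m) : θ i ≠ 0 := by
  intro hi
  have : DiscreteTopology {g : SymGroup m // act p g θ = θ} := h
  -- Rescaling only the vanishing unit fixes `θ`, which embeds a line continuously and injectively
  -- in a discrete isotropy group.
  have hfix : ∀ t : ℝ, act p
      ⟨fun j => ⟨Real.exp ((Pi.single i t : Fin m → ℝ) j), Real.exp_pos _⟩, 1⟩ θ = θ := by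
    intro t
    rw [← expScale_eq_act]
    funext j
    rcases eq_or_ne j i with rfl | hj
    · simp [expScale, hi]
    · simp [expScale, hj]
  let f : ℝ → {g : SymGroup m // act p g θ = θ} := fun t => ⟨_, hfix t⟩
  have hf : Continuous f := by
    refine Continuous.subtype_mk (continuous_inf_rng.2 ⟨?_, ?_⟩) _
    swap
    · exact continuous_induced_rng.2 (@continuous_const _ _ _ ⊥ 1)
    refine continuous_induced_rng.2 ?_
    refine continuous_pi fun j => Continuous.subtype_mk (Real.continuous_exp.comp ?_) _
    exact (continuous_apply j).comp (continuous_single (A := fun _ : Fin m => ℝ) i)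
  have hinj : Function.Injective f := by
    intro t u htu
    have h1 := congrArg (fun g => ((g.1.left i : PosReal) : ℝ)) htu
    simpa [f] using h1
  have hopen : IsOpen ({0} : Set ℝ) := by
    have h2 := (isOpen_discrete ({f 0} : Set _)).preimage hf
    rwa [← Set.image_singleton, hinj.preimage_image] at h2
  exact not_isOpen_singleton (0 : ℝ) hopen

/-- Near a nonzero unit there is a smooth function which measures the logarithm of the scaling
factor. -/
theorem exists_log_scale_unit {p : ℝ} (hp : 0 < p) {z₀ : ℝ × EuclideanSpace ℝ (Fin d)}
    (hz₀ : z₀ ≠ 0) :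
    ∃ (O : Set (ℝ × EuclideanSpace ℝ (Fin d))) (h : ℝ × EuclideanSpace ℝ (Fin d) → ℝ),
      IsOpen O ∧ z₀ ∈ O ∧ ContDiffOn ℝ ∞ h O ∧ h z₀ = 0 ∧
      ∀ z ∈ O, ∀ t : ℝ, (Real.exp (-p * t) * z.1, Real.exp t • z.2) ∈ O ∧
        h (Real.exp (-p * t) * z.1, Real.exp t • z.2) = t + h z := by
  -- A coordinate of `w` scales by `exp t`, and `a` by `exp (-p * t)`, whence the factor `-p⁻¹`.
  -- Signs do not matter, as `Real.log` depends only on the absolute value. Both choices of `O` are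
  -- invariant under all scalings.
  by_cases ha : z₀.1 = 0
  · have hw : ∃ j, z₀.2 j ≠ 0 := by
      by_contra! hw
      exact hz₀ (Prod.ext ha (by ext j; exact hw j))
    obtain ⟨j, hj⟩ := hw
    refine ⟨{z | z.2 j ≠ 0}, fun z => Real.log (z.2 j) - Real.log (z₀.2 j), ?_, hj, ?_, by simp, ?_⟩
    · exact isOpen_ne_fun (by fun_prop) continuous_const
    · exact ContDiffOn.sub (ContDiffOn.log (by fun_prop) fun z hz => hz) contDiffOn_const
    · intro z hz t
      have hz' : z.2 j ≠ 0 := hz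
      refine ⟨by simpa using hz', ?_⟩
      simp only [PiLp.smul_apply, smul_eq_mul]
      rw [Real.log_mul (Real.exp_ne_zero t) hz', Real.log_exp]
      ring
  · refine ⟨{z | z.1 ≠ 0}, fun z => -p⁻¹ * (Real.log z.1 - Real.log z₀.1), ?_, ha, ?_, by simp, ?_⟩
    · exact isOpen_ne_fun (by fun_prop) continuous_const
    · exact contDiffOn_const.mul
        (ContDiffOn.sub (ContDiffOn.log (by fun_prop) fun z hz => hz) contDiffOn_const)
    · intro z hz t
      have hz' : z.1 ≠ 0 := hz
      refine ⟨by simpa using hz', ?_⟩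
      simp only
      rw [Real.log_mul (Real.exp_ne_zero _) hz', Real.log_exp]
      field_simp
      ring

/-- Near a point without vanishing units there is a smooth function which measures the logarithms
of the scaling factors of all units. -/
theorem exists_log_scale {p : ℝ} (hp : 0 < p) {θ₀ : Param m d} (hθ₀ : ∀ i, θ₀ i ≠ 0) :
    ∃ (O : Set (Param m d)) (h : Param m d → Fin m → ℝ), IsOpen O ∧ θ₀ ∈ O ∧ ContDiffOn ℝ ∞ h O ∧
      h θ₀ = 0 ∧ ∀ θ ∈ O, ∀ ξ, expScale p ξ θ ∈ O ∧ h (expScale p ξ θ) = ξ + h θ := by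
  choose O h hO hmem hsmooth hzero hscale using fun i => exists_log_scale_unit hp (hθ₀ i)
  refine ⟨{θ | ∀ i, θ i ∈ O i}, fun θ i => h i (θ i), ?_, hmem, ?_, funext hzero, ?_⟩
  · rw [Set.ofPred_forall]
    exact isOpen_iInter_of_finite fun i => (hO i).preimage (continuous_apply i)
  · exact contDiffOn_pi.2 fun i =>
      (hsmooth i).comp (contDiff_apply ℝ _ i).contDiffOn fun θ hθ => hθ i
  · intro θ hθ ξ
    exact ⟨fun i => (hscale i _ (hθ i) (ξ i)).1, funext fun i => (hscale i _ (hθ i) (ξ i)).2⟩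

end ShallowNet

/-! ### Differentials and maps into embedded submanifolds. -/

section ChainRule

variable {E E' E'' : Type*} [NormedAddCommGroup E] [NormedSpace ℝ E] [NormedAddCommGroup E']
  [NormedSpace ℝ E'] [NormedAddCommGroup E''] [NormedSpace ℝ E'']
  {M M' M'' : Type*} [TopologicalSpace M] [ChartedSpace E M] [TopologicalSpace M']
  [ChartedSpace E' M'] [TopologicalSpace M''] [ChartedSpace E'' M'']

/-- The chain rule at a point given by an equation, for vectors of the model spaces. -/
theorem mfderiv_mfderiv_apply_of_eq {f : M → M'} {g : M' → M''} {x : M} {y : M'} (hxy : f x = y)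
    (hg : MDifferentiableAt 𝓘(ℝ, E') 𝓘(ℝ, E'') g y)
    (hf : MDifferentiableAt 𝓘(ℝ, E) 𝓘(ℝ, E') f x) (v : E) :
    (mfderiv 𝓘(ℝ, E') 𝓘(ℝ, E'') g y : E' →L[ℝ] E'')
      ((mfderiv 𝓘(ℝ, E) 𝓘(ℝ, E') f x : E →L[ℝ] E') v) =
      (mfderiv 𝓘(ℝ, E) 𝓘(ℝ, E'') (g ∘ f) x : E →L[ℝ] E'') v := by
  subst hxy
  rw [mfderiv_comp x hg hf]
  rfl

/-- A map into the source of a smooth embedding is smooth if its composition with the embedding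
is. -/
theorem Manifold.IsSmoothEmbedding.contMDiffAt_of_comp {ι : M' → M''}
    [IsManifold 𝓘(ℝ, E) ∞ M] [IsManifold 𝓘(ℝ, E') ∞ M'] [IsManifold 𝓘(ℝ, E'') ∞ M'']
    (hι : Manifold.IsSmoothEmbedding 𝓘(ℝ, E') 𝓘(ℝ, E'') ∞ ι) {f : M → M'} {x : M}
    (hf : ContMDiffAt 𝓘(ℝ, E) 𝓘(ℝ, E'') ∞ (ι ∘ f) x) :
    ContMDiffAt 𝓘(ℝ, E) 𝓘(ℝ, E') ∞ f x :=
  (ContMDiffAt.iff_comp_isImmersionAt (hι.isImmersion.isImmersionAt (f x))).2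
    ⟨hι.isEmbedding.isInducing.continuousAt_iff.2 hf.continuousAt, hf⟩

end ChainRule

namespace ShallowNet

/-! ### Topology of the orbit space. -/

section OpenQuotient

variable {m d : ℕ} {p : ℝ} {S : Set (Param m d)}

/-- The saturation of an open set is a union of its preimages under group elements. -/
theorem isOpenQuotientMap_proj (hinv : IsInvariant p S) : IsOpenQuotientMap (proj p S) where
  surjective := Quotient.mk_surjective
  continuous := continuous_quotient_mk'
  isOpenMap := by
    intro U hU
    have h : proj p S ⁻¹' (proj p S '' U) =
        ⋃ g : SymGroup m, (fun x : S => (⟨act p g x, hinv g x x.2⟩ : S)) ⁻¹' U := by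
      ext x
      simp only [Set.mem_preimage, Set.mem_image, Set.mem_iUnion]
      constructor
      · rintro ⟨y, hy, hyx⟩
        obtain ⟨g, hg⟩ := Quotient.exact hyx.symm
        exact ⟨g, by convert hy⟩
      · rintro ⟨g, hg⟩
        exact ⟨_, hg, (Quotient.sound (s := orbitSetoid p S) ⟨g, rfl⟩).symm⟩
    refine isQuotientMap_quotient_mk'.isOpen_preimage.1 ?_
    change IsOpen (proj p S ⁻¹' (proj p S '' U))
    rw [h]
    refine isOpen_iUnion fun g => hU.preimage ?_
    exact ((contDiff_act p g).continuous.comp continuous_subtype_val).subtype_mk _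

/-- For an open quotient, Hausdorff means that the relation is closed; here it is the range of a
proper map. -/
theorem t2Space_orbitSpace (hinv : IsInvariant p S) (hproper : IsProperAction p S hinv) :
    T2Space (OrbitSpace p S) := by
  rw [t2Space_iff_of_isOpenQuotientMap (isOpenQuotientMap_proj hinv)]
  convert hproper.isClosed_range using 1
  ext ⟨x, y⟩
  simp only [Set.mem_ofPred_eq, Set.mem_range, Prod.exists, Prod.mk.injEq]
  constructor
  · intro h
    obtain ⟨g, hg⟩ := Quotient.exact h.symm
    exact ⟨g, y, Subtype.ext hg, rfl⟩
  · rintro ⟨g, z, rfl, rfl⟩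
    exact (Quotient.sound (s := orbitSetoid p S) ⟨g, rfl⟩).symm

end OpenQuotient

/-! ### Slices in the regular set. -/

section RegularSet

variable {m d n : ℕ} {p : ℝ} {S : Set (Param m d)}
  [ChartedSpace (EuclideanSpace ℝ (Fin n)) S] [IsManifold (𝓡 n) ∞ S]

theorem exists_smooth_symmetry
    (hemb : Manifold.IsSmoothEmbedding (𝓡 n) 𝓘(ℝ, Param m d) ∞ (Subtype.val : S → Param m d))
    (hinv : IsInvariant p S) (x x' : S) (h : proj p S x = proj p S x') :
    ∃ γ : S → S, ContMDiff (𝓡 n) (𝓡 n) ∞ γ ∧ γ x = x' ∧ ∀ z, proj p S (γ z) = proj p S z := by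
  obtain ⟨g, hg⟩ := Quotient.exact h
  refine ⟨fun z => ⟨act p g z, hinv g z z.2⟩, fun z => ?_, Subtype.ext hg, fun z => ?_⟩
  · refine hemb.contMDiffAt_of_comp ?_
    exact ((contDiff_act p g).contMDiff _).comp z (hemb.contMDiff z)
  · exact (Quotient.sound (s := orbitSetoid p S) ⟨g, rfl⟩).symm

/-- The orbit of a point of an invariant set under the group of scalings, parametrized by the
logarithms of the scaling factors. -/
def orbitMap (hinv : IsInvariant p S) (x : S) (ξ : Fin m → ℝ) : S :=
  ⟨expScale p ξ x, by rw [expScale_eq_act]; exact hinv _ _ x.2⟩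

omit [ChartedSpace (EuclideanSpace ℝ (Fin n)) S] [IsManifold (𝓡 n) ∞ S] in
theorem orbitMap_zero (hinv : IsInvariant p S) (x : S) : orbitMap hinv x 0 = x :=
  Subtype.ext (expScale_zero p _)

omit [ChartedSpace (EuclideanSpace ℝ (Fin n)) S] [IsManifold (𝓡 n) ∞ S] in
theorem proj_orbitMap (hinv : IsInvariant p S) (x : S) (ξ : Fin m → ℝ) :
    proj p S (orbitMap hinv x ξ) = proj p S x :=
  (Quotient.sound (s := orbitSetoid p S) ⟨_, (expScale_eq_act p ξ x.1).symm⟩).symm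

/-- Base point and parameter vary together because the retraction onto the slice scales `x` by the
`x`-dependent amount `-H x`. -/
theorem contMDiffAt_orbitMap
    (hemb : Manifold.IsSmoothEmbedding (𝓡 n) 𝓘(ℝ, Param m d) ∞ (Subtype.val : S → Param m d))
    (hinv : IsInvariant p S) {E M : Type*} [NormedAddCommGroup E] [NormedSpace ℝ E]
    [TopologicalSpace M] [ChartedSpace E M] [IsManifold 𝓘(ℝ, E) ∞ M] {f : M → S}
    {η : M → Fin m → ℝ} {z : M} (hf : ContMDiffAt 𝓘(ℝ, E) (𝓡 n) ∞ f z)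
    (hη : ContMDiffAt 𝓘(ℝ, E) 𝓘(ℝ, Fin m → ℝ) ∞ η z) :
    ContMDiffAt 𝓘(ℝ, E) (𝓡 n) ∞ (fun y => orbitMap hinv (f y) (η y)) z := by
  refine hemb.contMDiffAt_of_comp ?_
  have h1 : ContMDiffAt 𝓘(ℝ, E) 𝓘(ℝ, (Fin m → ℝ) × Param m d) ∞ (fun y => (η y, (f y).1)) z :=
    hη.prodMk_space ((hemb.contMDiff (f z)).comp z hf)
  exact ((contDiff_expScale p).contMDiff _).comp z h1

/-- If the kernel of the differential of the realization map at a point is the tangent space of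
the orbit, then tangent vectors of the regular set which are annihilated by it are velocities of
the scaling action. -/
theorem exists_mfderiv_orbitMap_eq {F : Type*} [NormedAddCommGroup F] [NormedSpace ℝ F]
    (hemb : Manifold.IsSmoothEmbedding (𝓡 n) 𝓘(ℝ, Param m d) ∞ (Subtype.val : S → Param m d))
    (hinv : IsInvariant p S) {Φ : Param m d → F} (x : S) (hdiff : DifferentiableAt ℝ Φ x)
    (hker : LinearMap.ker (fderiv ℝ Φ x : Param m d →ₗ[ℝ] F) = orbitTangent p x.1)
    (w : EuclideanSpace ℝ (Fin n))
    (hw : (mfderiv (𝓡 n) 𝓘(ℝ, F) (fun y : S => Φ y) x : EuclideanSpace ℝ (Fin n) →L[ℝ] F) w = 0) :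
    ∃ ξ : Fin m → ℝ, (mfderiv 𝓘(ℝ, Fin m → ℝ) (𝓡 n) (orbitMap hinv x) 0 :
      (Fin m → ℝ) →L[ℝ] EuclideanSpace ℝ (Fin n)) ξ = w := by
  have hval : MDifferentiableAt (𝓡 n) 𝓘(ℝ, Param m d) (Subtype.val : S → Param m d) x :=
    (hemb.contMDiff x).mdifferentiableAt (by simp)
  have horb : MDifferentiableAt 𝓘(ℝ, Fin m → ℝ) (𝓡 n) (orbitMap hinv x) 0 :=
    (contMDiffAt_orbitMap hemb hinv contMDiffAt_const contMDiffAt_id).mdifferentiableAt (by simp)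
  have h1 := mfderiv_mfderiv_apply_of_eq (g := Φ) rfl hdiff.mdifferentiableAt hval w
  have h2 := h1.trans hw
  rw [mfderiv_eq_fderiv] at h2
  have h3 : (mfderiv (𝓡 n) 𝓘(ℝ, Param m d) (Subtype.val : S → Param m d) x :
      EuclideanSpace ℝ (Fin n) →L[ℝ] Param m d) w ∈ orbitTangent p x.1 := by
    rw [← hker]
    exact h2
  obtain ⟨ξ, hξ⟩ := h3
  -- The inclusion has injective differential, so the two tangent vectors may be compared in `Θ`.
  refine ⟨ξ, (hemb.isImmersion.isImmersionAt x).mfderiv_injective ?_⟩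
  refine (mfderiv_mfderiv_apply_of_eq (orbitMap_zero hinv x) hval horb ξ).trans (Eq.trans ?_ hξ)
  rw [mfderiv_eq_fderiv]
  exact fderiv_expScale p x.1 ξ

/-- Near every point of the regular set the orbits are the fibres of a submersion with a smooth
section, and they are separated by the realization map. -/
theorem exists_localQuotient {F : Type*} [NormedAddCommGroup F] [NormedSpace ℝ F] (hp : 0 < p)
    (hemb : Manifold.IsSmoothEmbedding (𝓡 n) 𝓘(ℝ, Param m d) ∞ (Subtype.val : S → Param m d))
    (hinv : IsInvariant p S) (hne : ∀ θ ∈ S, ∀ i, θ i ≠ 0) {Φ : Param m d → F}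
    (hact : ∀ g θ, Φ (act p g θ) = Φ θ) (hdiff : ∀ θ ∈ S, DifferentiableAt ℝ Φ θ)
    (hC1 : ContMDiff (𝓡 n) 𝓘(ℝ, F) 1 (fun x : S => Φ x))
    (hker : ∀ θ ∈ S, LinearMap.ker (fderiv ℝ Φ θ : Param m d →ₗ[ℝ] F) = orbitTangent p θ)
    (x₀ : S) :
    ∃ D : LocalQuotient (EuclideanSpace ℝ (Fin n)) (EuclideanSpace ℝ (Fin (n - m))) (proj p S),
      x₀ ∈ D.U ∧ ∀ a ∈ D.U, ∀ b ∈ D.U, Φ a = Φ b → proj p S a = proj p S b := by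
  obtain ⟨O, h, hO, hx₀O, hh, hh₀, hscale⟩ := exists_log_scale hp (hne x₀ x₀.2)
  let H : S → Fin m → ℝ := fun x => h x
  let U₀ : Set S := Subtype.val ⁻¹' O
  have hU₀ : IsOpen U₀ := hO.preimage continuous_subtype_val
  have hH : ContMDiffOn (𝓡 n) 𝓘(ℝ, Fin m → ℝ) ∞ H U₀ :=
    (contMDiffOn_iff_contDiffOn.2 hh).comp hemb.contMDiff.contMDiffOn fun x hx => hx
  have hHd : ∀ x ∈ U₀, MDifferentiableAt (𝓡 n) 𝓘(ℝ, Fin m → ℝ) H x := fun x hx =>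
    (hH.contMDiffAt (hU₀.mem_nhds hx)).mdifferentiableAt (by simp)
  have horb : ∀ x, MDifferentiableAt 𝓘(ℝ, Fin m → ℝ) (𝓡 n) (orbitMap hinv x) 0 := fun x =>
    (contMDiffAt_orbitMap hemb hinv contMDiffAt_const contMDiffAt_id).mdifferentiableAt (by simp)
  -- Equivariance of `H` makes `dH` a left inverse of the differential of the orbit map, so `H` is a
  -- submersion.
  have hHorb : ∀ x ∈ U₀, ∀ ξ : Fin m → ℝ, (mfderiv (𝓡 n) 𝓘(ℝ, Fin m → ℝ) H x :
      EuclideanSpace ℝ (Fin n) →L[ℝ] Fin m → ℝ) ((mfderiv 𝓘(ℝ, Fin m → ℝ) (𝓡 n) (orbitMap hinv x) 0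
        : (Fin m → ℝ) →L[ℝ] EuclideanSpace ℝ (Fin n)) ξ) = ξ := by
    intro x hx ξ
    refine (mfderiv_mfderiv_apply_of_eq (orbitMap_zero hinv x) (hHd x hx) (horb x) ξ).trans ?_
    have h1 : H ∘ orbitMap hinv x = fun ξ => ξ + H x := funext fun ξ => (hscale _ hx ξ).2
    rw [h1, mfderiv_eq_fderiv, fderiv_add_const, fderiv_fun_id]
    rfl
  have hsurj : Function.Surjective (mfderiv (𝓡 n) 𝓘(ℝ, Fin m → ℝ) H x₀) :=
    fun ξ => ⟨_, hHorb x₀ hx₀O ξ⟩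
  -- This makes the truncated `n - m` the true dimension of the level set.
  have hmn : m ≤ n := by
    let A : EuclideanSpace ℝ (Fin n) →L[ℝ] Fin m → ℝ := mfderiv (𝓡 n) 𝓘(ℝ, Fin m → ℝ) H x₀
    simpa using LinearMap.finrank_le_finrank_of_surjective (f := A.toLinearMap) hsurj
  obtain ⟨W, V, s, ρ, hW, hV, hx₀W, hWU, hρ, hs, hsρ, hVs⟩ :=
    exists_levelSet_parametrization (G := EuclideanSpace ℝ (Fin (n - m))) (by simp; omega)
      hU₀ hH hx₀O hsurj
  have hH₀ : H x₀ = 0 := hh₀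
  rw [hH₀] at hsρ hVs
  obtain ⟨hv₀, hsv₀⟩ := hsρ x₀ hx₀W hH₀
  set v₀ := ρ x₀
  -- the realization map is locally injective on the slice
  have hsat : ContMDiffAt 𝓘(ℝ, EuclideanSpace ℝ (Fin (n - m))) (𝓡 n) ∞ s v₀ :=
    hs.contMDiffAt (hV.mem_nhds hv₀)
  have hsd := hsat.mdifferentiableAt (by simp)
  have hΦs : ContDiffAt ℝ 1 ((fun x : S => Φ x) ∘ s) v₀ :=
    contMDiffAt_iff_contDiffAt.1 ((hC1 _).comp v₀ (hsat.of_le (by simp)))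
  -- If `d(Φ ∘ s) u = 0`, then `ds u` is the orbit velocity of some `ξ`. Since `H ∘ s` is constant,
  -- `dH` kills it, so `ξ = 0` and `ds u = 0`; then `ρ ∘ s = id` gives `u = 0`.
  have hinj : Function.Injective (fderiv ℝ ((fun x : S => Φ x) ∘ s) v₀) := by
    rw [injective_iff_map_eq_zero]
    intro u hu
    rw [← mfderiv_eq_fderiv] at hu
    have h1 := (mfderiv_mfderiv_apply_of_eq hsv₀
      ((hC1 x₀).mdifferentiableAt (by simp)) hsd u).trans hu
    obtain ⟨ξ, hξ⟩ := exists_mfderiv_orbitMap_eq hemb hinv x₀ (hdiff _ x₀.2) (hker _ x₀.2) _ h1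
    have h2 := mfderiv_mfderiv_apply_of_eq hsv₀ (hHd x₀ hx₀O) hsd u
    have h3 : H ∘ s =ᶠ[𝓝 v₀] fun _ => 0 := by
      filter_upwards [hV.mem_nhds hv₀] with v hv
      exact (hVs v hv).2.1
    rw [h3.mfderiv_eq, mfderiv_const] at h2
    have hξ₀ : ξ = 0 := (hHorb x₀ hx₀O ξ).symm.trans ((congrArg (mfderiv (𝓡 n) 𝓘(ℝ, Fin m → ℝ) H x₀ :
      EuclideanSpace ℝ (Fin n) →L[ℝ] Fin m → ℝ) hξ).trans h2)
    have hsu := (hξ.symm.trans (congrArg _ hξ₀)).trans (map_zero _)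
    have h4 := mfderiv_mfderiv_apply_of_eq (g := ρ) hsv₀
      ((hρ.contMDiffAt (hW.mem_nhds hx₀W)).mdifferentiableAt (by simp)) hsd u
    have h5 : ρ ∘ s =ᶠ[𝓝 v₀] id := by
      filter_upwards [hV.mem_nhds hv₀] with v hv
      exact (hVs v hv).2.2
    rw [h5.mfderiv_eq, mfderiv_id] at h4
    exact h4.symm.trans ((congrArg (mfderiv (𝓡 n) 𝓘(ℝ, EuclideanSpace ℝ (Fin (n - m))) ρ x₀ :
      EuclideanSpace ℝ (Fin n) →L[ℝ] EuclideanSpace ℝ (Fin (n - m))) hsu).trans (map_zero _))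
  obtain ⟨N, hN, hNinj⟩ := (hΦs.hasStrictFDerivAt (by simp)).exists_injOn_of_injective hinj
  obtain ⟨V', hV'N, hV', hv₀V'⟩ := mem_nhds_iff.1 (Filter.inter_mem (hV.mem_nhds hv₀) hN)
  -- the smooth retraction onto the slice along the orbits
  let r : S → S := fun x => orbitMap hinv x (-H x)
  have hr : ContMDiffOn (𝓡 n) (𝓡 n) ∞ r U₀ := by
    intro x hx
    exact (contMDiffAt_orbitMap hemb hinv contMDiffAt_id
      (hH.contMDiffAt (hU₀.mem_nhds hx)).neg).contMDiffWithinAt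
  have hHr : ∀ x ∈ U₀, H (r x) = 0 := fun x hx => by
    have := (hscale _ hx (-H x)).2
    exact this.trans (neg_add_cancel _)
  have hrH : ∀ x, H x = 0 → r x = x := fun x hx => by
    simp only [r, hx, neg_zero, orbitMap_zero]
  have hqr : ∀ x, proj p S (r x) = proj p S x := fun x => proj_orbitMap hinv x _
  have hΦq : ∀ a b : S, proj p S a = proj p S b → Φ a = Φ b := fun a b hab => by
    obtain ⟨g, hg⟩ := Quotient.exact hab
    rw [← hg, hact]
  have hUW : IsOpen (U₀ ∩ r ⁻¹' W) := hr.continuousOn.isOpen_inter_preimage hU₀ hW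
  have hψ : ContMDiffOn (𝓡 n) 𝓘(ℝ, EuclideanSpace ℝ (Fin (n - m))) ∞ (ρ ∘ r) (U₀ ∩ r ⁻¹' W) :=
    hρ.comp (hr.mono Set.inter_subset_left) fun x hx => hx.2
  have hsψ : ∀ x ∈ U₀ ∩ r ⁻¹' W, s (ρ (r x)) = r x := fun x hx => (hsρ _ hx.2 (hHr x hx.1)).2
  -- Retraction preserves `Φ`, so equal values put both retracts at the same slice point. This also
  -- handles points related by permutations.
  have hinjU : ∀ a ∈ (U₀ ∩ r ⁻¹' W) ∩ (ρ ∘ r) ⁻¹' V', ∀ b ∈ (U₀ ∩ r ⁻¹' W) ∩ (ρ ∘ r) ⁻¹' V',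
      Φ a = Φ b → ρ (r a) = ρ (r b) := by
    intro a ha b hb hab
    refine hNinj (hV'N ha.2).2 (hV'N hb.2).2 ?_
    change Φ (s (ρ (r a))) = Φ (s (ρ (r b)))
    rw [hsψ a ha.1, hsψ b hb.1, hΦq _ _ (hqr a), hΦq _ _ (hqr b), hab]
  have hproj : ∀ a ∈ (U₀ ∩ r ⁻¹' W) ∩ (ρ ∘ r) ⁻¹' V', ∀ b ∈ (U₀ ∩ r ⁻¹' W) ∩ (ρ ∘ r) ⁻¹' V',
      ρ (r a) = ρ (r b) → proj p S a = proj p S b := by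
    intro a ha b hb hab
    rw [← hqr a, ← hqr b, ← hsψ a ha.1, ← hsψ b hb.1, hab]
  have hrs : ∀ v ∈ V, r (s v) = s v := fun v hv => hrH _ (hVs v hv).2.1
  refine ⟨{
    U := (U₀ ∩ r ⁻¹' W) ∩ (ρ ∘ r) ⁻¹' V'
    V := V'
    ψ := ρ ∘ r
    s := s
    isOpen_U := hψ.continuousOn.isOpen_inter_preimage hUW hV'
    isOpen_V := hV'
    contMDiffOn_ψ := hψ.mono Set.inter_subset_left
    contMDiffOn_s := hs.mono fun v hv => (hV'N hv).1
    ψ_mem := fun x hx => hx.2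
    s_mem := fun v hv => ?_
    ψ_s := fun v hv => ?_
    eq_iff := fun a ha b hb => ⟨fun hab => hinjU a ha b hb (hΦq a b hab), hproj a ha b hb⟩ },
    ?_, fun a ha b hb hab => hproj a ha b hb (hinjU a ha b hb hab)⟩
  · have hv' := (hV'N hv).1
    have h1 := hVs v hv'
    refine ⟨⟨hWU h1.1, ?_⟩, ?_⟩
    · rw [Set.mem_preimage, hrs v hv']
      exact h1.1
    · rw [Set.mem_preimage, Function.comp_apply, hrs v hv', h1.2.2]
      exact hv
  · rw [Function.comp_apply, hrs v (hV'N hv).1, (hVs v (hV'N hv).1).2.2]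
  · have h1 := hrH x₀ hH₀
    refine ⟨⟨hx₀O, ?_⟩, ?_⟩
    · rwa [Set.mem_preimage, h1]
    · rwa [Set.mem_preimage, Function.comp_apply, h1]

end RegularSet

end ShallowNet

end

/-! ### Assembly and the descended map. -/

theorem mainTheorem1
    (m d n : ℕ) (p : ℝ) (hp : 0 < p) (σ : ℝ → ℝ)
    (hσ_C1 : ContDiffOn ℝ 1 σ {0}ᶜ)
    (hσ_hom : ∀ c t : ℝ, 0 < c → σ (c * t) = c ^ p * σ t)
    {F : Type*} [NormedAddCommGroup F] [NormedSpace ℝ F]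
    (J : ShallowNet.featureSpan σ d →ₗ[ℝ] F)
    -- the regular set, an invariant smooth embedded submanifold of `Θ` of dimension `n`
    (Θreg : Set (ShallowNet.Param m d))
    [ChartedSpace (EuclideanSpace ℝ (Fin n)) Θreg] [IsManifold (𝓡 n) ∞ Θreg]
    (hemb : Manifold.IsSmoothEmbedding (𝓡 n) 𝓘(ℝ, ShallowNet.Param m d) ∞
      (Subtype.val : Θreg → ShallowNet.Param m d))
    (hinv : ShallowNet.IsInvariant p Θreg)
    (hfree : ∀ θ ∈ Θreg, ShallowNet.IsLocallyFreeAt p θ)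
    (hproper : ShallowNet.IsProperAction p Θreg hinv)
    -- `Φ` has a differential at the points of `Θreg`, and is of class `C^1` on `Θreg`
    (hdiff : ∀ θ ∈ Θreg, DifferentiableAt ℝ
      (ShallowNet.realization σ J : ShallowNet.Param m d → F) θ)
    (hC1 : ContMDiff (𝓡 n) 𝓘(ℝ, F) 1 (fun θ : Θreg => ShallowNet.realization σ J θ.1))
    (hker : ∀ θ ∈ Θreg,
      LinearMap.ker (fderiv ℝ (ShallowNet.realization σ J : ShallowNet.Param m d → F) θ :
        ShallowNet.Param m d →ₗ[ℝ] F) = ShallowNet.orbitTangent p θ) :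
    -- the orbit space is a smooth manifold and the quotient map is a smooth submersion
    T2Space (ShallowNet.OrbitSpace p Θreg) ∧
    SecondCountableTopology (ShallowNet.OrbitSpace p Θreg) ∧
    ∃ _ : ChartedSpace (EuclideanSpace ℝ (Fin (n - m))) (ShallowNet.OrbitSpace p Θreg),
      IsManifold (𝓡 (n - m)) ∞ (ShallowNet.OrbitSpace p Θreg) ∧
      ContMDiff (𝓡 n) (𝓡 (n - m)) ∞ (ShallowNet.proj p Θreg) ∧
      (∀ θ : Θreg, Function.Surjective
        (mfderiv (𝓡 n) (𝓡 (n - m)) (ShallowNet.proj p Θreg) θ)) ∧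
      -- `Φ` descends to the orbit space
      ∃ Φbar : ShallowNet.OrbitSpace p Θreg → F,
        (∀ θ : Θreg, Φbar (ShallowNet.proj p Θreg θ) = ShallowNet.realization σ J θ.1) ∧
        -- the descended map is `C^1`, and is as smooth as `Φ` is on `Θreg`
        ContMDiff (𝓡 (n - m)) 𝓘(ℝ, F) 1 Φbar ∧
        (∀ k : ℕ∞,
          ContMDiff (𝓡 n) 𝓘(ℝ, F) k (fun θ : Θreg => ShallowNet.realization σ J θ.1) →
          ContMDiff (𝓡 (n - m)) 𝓘(ℝ, F) k Φbar) ∧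
        -- it is locally injective, with an injective differential at every point
        (∀ y, ∃ U ∈ 𝓝 y, Set.InjOn Φbar U) ∧
        (∀ y, Function.Injective (mfderiv (𝓡 (n - m)) 𝓘(ℝ, F) Φbar y)) := by

  open ShallowNet in
  have hne : ∀ θ ∈ Θreg, ∀ i, θ i ≠ 0 := fun θ hθ => (hfree θ hθ).apply_ne_zero
  have hq := isOpenQuotientMap_proj hinv
  have hact := realization_act (m := m) hσ_hom J
  choose D hD hDinj using exists_localQuotient hp hemb hinv hne hact hdiff hC1 hker
  obtain ⟨cs, hman, hsmooth, hsec⟩ := hq.exists_isManifold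
    (exists_smooth_symmetry hemb hinv) fun x => ⟨D x, hD x⟩
  have hqd : ∀ θ : Θreg, MDifferentiableAt (𝓡 n) (𝓡 (n - m)) (proj p Θreg) θ := fun θ =>
    (hsmooth θ).mdifferentiableAt (by simp)
  -- the differential of the quotient map is inverted by that of a local section
  have hqt : ∀ (θ : Θreg) (t : OrbitSpace p Θreg → Θreg), t (proj p Θreg θ) = θ →
      MDifferentiableAt (𝓡 (n - m)) (𝓡 n) t (proj p Θreg θ) →
      (∀ᶠ y in 𝓝 (proj p Θreg θ), proj p Θreg (t y) = y) →
      ∀ u : EuclideanSpace ℝ (Fin (n - m)), (mfderiv (𝓡 n) (𝓡 (n - m)) (proj p Θreg) θ :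
        EuclideanSpace ℝ (Fin n) →L[ℝ] EuclideanSpace ℝ (Fin (n - m)))
        ((mfderiv (𝓡 (n - m)) (𝓡 n) t (proj p Θreg θ) :
          EuclideanSpace ℝ (Fin (n - m)) →L[ℝ] EuclideanSpace ℝ (Fin n)) u) = u := by
    intro θ t ht htd hqt u
    refine (mfderiv_mfderiv_apply_of_eq ht (hqd θ) htd u).trans ?_
    have h1 : proj p Θreg ∘ t =ᶠ[𝓝 (proj p Θreg θ)] id := hqt
    rw [h1.mfderiv_eq, mfderiv_id]
    rfl
  let Φbar : OrbitSpace p Θreg → F := Quotient.lift (fun θ : Θreg => realization σ J θ.1) (by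
    rintro a b ⟨g, hg⟩
    rw [← hg, hact])
  have hΦbar : ∀ k : ℕ∞, ContMDiff (𝓡 n) 𝓘(ℝ, F) k (fun θ : Θreg => realization σ J θ.1) →
      ContMDiff (𝓡 (n - m)) 𝓘(ℝ, F) k Φbar := by
    intro k hk y
    obtain ⟨θ, rfl⟩ := hq.surjective y
    obtain ⟨t, ht, hts, hqt⟩ := hsec θ
    have h1 : ContMDiffAt (𝓡 (n - m)) 𝓘(ℝ, F) k
        (fun y => realization σ J (t y).1) (proj p Θreg θ) :=
      (hk _).comp _ (hts.of_le (by exact_mod_cast le_top))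
    refine h1.congr_of_eventuallyEq ?_
    filter_upwards [hqt] with y hy
    rw [← hy]
    exact congrArg (fun z => realization σ J (t z).1) hy.symm
  have hΦbar1 : ContMDiff (𝓡 (n - m)) 𝓘(ℝ, F) 1 Φbar := hΦbar 1 hC1
  refine ⟨t2Space_orbitSpace hinv hproper, hq.isQuotientMap.secondCountableTopology hq.isOpenMap,
    cs, hman, hsmooth, fun θ u => ?_, Φbar, fun _ => rfl, hΦbar1, hΦbar, fun y => ?_, fun y => ?_⟩
  · obtain ⟨t, ht, hts, hqt'⟩ := hsec θ
    exact ⟨_, hqt θ t ht (hts.mdifferentiableAt (by simp)) hqt' u⟩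
  · obtain ⟨θ, rfl⟩ := hq.surjective y
    refine ⟨proj p Θreg '' (D θ).U,
      (hq.isOpenMap _ (D θ).isOpen_U).mem_nhds ⟨θ, hD θ, rfl⟩, ?_⟩
    rintro _ ⟨a, ha, rfl⟩ _ ⟨b, hb, rfl⟩ hab
    exact hDinj θ a ha b hb hab
  · obtain ⟨θ, rfl⟩ := hq.surjective y
    obtain ⟨t, ht, hts, hqt'⟩ := hsec θ
    have htd := hts.mdifferentiableAt (by simp)
    rw [injective_iff_map_eq_zero]
    intro u hu
    -- `u` is the image of a velocity of the scaling action
    have hΦd := (hC1 θ).mdifferentiableAt (by simp)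
    have h1 := mfderiv_mfderiv_apply_of_eq ht hΦd htd u
    have h2 : (fun θ : Θreg => realization σ J θ.1) ∘ t =ᶠ[𝓝 (proj p Θreg θ)] Φbar := by
      filter_upwards [hqt'] with z hz
      exact congrArg Φbar hz
    rw [h2.mfderiv_eq] at h1
    obtain ⟨ξ, hξ⟩ := exists_mfderiv_orbitMap_eq hemb hinv θ (hdiff θ θ.2) (hker θ θ.2) _
      (h1.trans hu)
    have horb : MDifferentiableAt 𝓘(ℝ, Fin m → ℝ) (𝓡 n) (orbitMap hinv θ) 0 :=
      (contMDiffAt_orbitMap hemb hinv contMDiffAt_const contMDiffAt_id).mdifferentiableAt (by simp)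
    -- The quotient map is constant along orbits, so its differential kills the velocity `dt u`; but
    -- it sends `dt u` to `u`.
    have h3 := mfderiv_mfderiv_apply_of_eq (orbitMap_zero hinv θ) (hqd θ) horb ξ
    have h4 : proj p Θreg ∘ orbitMap hinv θ = fun _ => proj p Θreg θ :=
      funext fun ξ => proj_orbitMap hinv θ ξ
    rw [h4, mfderiv_const] at h3
    exact (hqt θ t ht htd hqt' u).symm.trans ((congrArg (mfderiv (𝓡 n) (𝓡 (n - m)) (proj p Θreg) θ :
      EuclideanSpace ℝ (Fin n) →L[ℝ] EuclideanSpace ℝ (Fin (n - m))) hξ).symm.trans h3)
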